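/- Let $n\ge 2$, let $S(n-1)$ act on $\{1,\dots,n-1\}$ and let $S(n-2)\subset S(n-1)$ be the subgroup fixing the point $n-1$. Write $(a,n-1)$ for the transposition of $a$ and $n-1$ (the identity if $a=n-1$). Fix pairwise inequivalent complex matrix irreps $\varphi^{\xi}$ of $S(n-2)$, of dimension $d_\xi$. A partially reduced irreducible representation (PRIR) of $S(n-1)$ is a unitary matrix irrep $\psi_R$ whose restriction to $S(n-2)$ is the block-diagonal matrix $\psi_R(\pi)=\bigoplus_{\xi}\varphi^{\xi}(\pi)$, where $\xi$ runs, each value once, over a finite set of labels (one writes $\xi\in\psi_R$). Its rows and columns are accordingly indexed by pairs $(\xi,j_\xi)$ with $\xi\in\psi_R$, $1\le j_\xi\le d_\xi$, and its entries are written $(\psi_R)^{\xi\zeta}_{j_\xi j_\zeta}(\sigma)$. Fix one of the labels, $\alpha$, and let $\Phi^\alpha=\operatorname{ind}_{S(n-2)}^{S(n-1)}\varphi^\alpha$ be the induced representation in its standard matrix form $$\Phi^\alpha(\sigma)^{ab}_{kl}=\delta_{a,\sigma(b)}\,\varphi^\alpha_{kl}\big[(a,n-1)\,\sigma\,(b,n-1)\big],\qquad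 a,b=1,\dots,n-1,\quad k,l=1,\dots,d_\alpha .$$ Let $(\psi_R^\nu)_{\nu\in\Phi^\alpha}$ be PRIRs of $S(n-1)$, of dimensions $d_\nu$, representing each equivalence class of irreps of $S(n-1)$ contained in $\Phi^\alpha$ exactly once. Then $\alpha\in\psi_R^\nu$ for every $\nu\in\Phi^\alpha$, and the matrix $Z_R(\alpha)$ with rows $(a,k_\alpha)$, columns $(\nu,\xi_\nu,j_{\xi_\nu})$ (where $\xi_\nu\in\psi_R^\nu$) and entries $$z_R(\alpha)^{a\,\xi_\nu}_{k_\alpha j_{\xi_\nu}}=\frac{1}{\sqrt{n-1}}\,\frac{\sqrt{d_\nu}}{\sqrt{d_\alpha}}\;(\psi_R^\nu)^{\alpha\,\xi_\nu}_{k_\alpha j_{\xi_\nu}}\big[(a,n-1)\big]$$ is a square unitary matrix which reduces $\Phi^\alpha$ to $\bigoplus_{\nu\in\Phi^\alpha}\psi_R^\nu$: $$Z_R^\dagger Z_R=\mathbf 1,\qquad Z_RZ_R^\dagger=\mathbf 1,\qquad Z_R^\dagger\,\Phi^\alpha(\sigma)\,Z_R=\bigoplus_{\nu\in\Phi^\alpha}\psi_R^\nu(\sigma)\quad\text{for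 all }\sigma\in S(n-1).$$ Moreover every unitary matrix that reduces $\Phi^\alpha$ to $\bigoplus_{\nu}\psi_R^\nu$ in this sense is obtained from $Z_R(\alpha)$ by multiplying, for each $\nu$, the columns belonging to $\nu$ by a complex number of modulus one. -/

import Mathlib

open scoped Matrix

namespace PRIRep

/-- A matrix representation seen as a representation on the space of column vectors. -/
noncomputable def toRep {G ι : Type*} [Monoid G] [Fintype ι] [DecidableEq ι]
    (ρ : G →* Matrix ι ι ℂ) : Representation ℂ G (ι → ℂ) :=
  ((Matrix.toLinAlgEquiv' : Matrix ι ι ℂ ≃ₐ[ℂ] _) : Matrix ι ι ℂ →* _).comp ρ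

/-- The group `S(n-1)`, with `n = m + 2`, acting on the `n - 1 = m + 1` points of `Fin (m + 1)`. -/
abbrev Sym (m : ℕ) : Type := Equiv.Perm (Fin (m + 1))

/-- The subgroup `S(n-2)` of `S(n-1)`: the permutations that fix the last point. -/
abbrev SymSub (m : ℕ) : Subgroup (Sym m) := MulAction.stabilizer (Sym m) (Fin.last m)

/-- The transposition `(a, n-1)` of `a` and the last point (the identity if `a` is the last
point). -/
def tr {m : ℕ} (a : Fin (m + 1)) : Sym m := Equiv.swap a (Fin.last m)

theorem tr_mul_tr {m : ℕ} (a : Fin (m + 1)) : tr a * tr a = 1 := Equiv.swap_mul_self _ _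

theorem conj_mem {m : ℕ} {σ : Sym m} {a b : Fin (m + 1)} (h : a = σ b) :
    tr a * σ * tr b ∈ SymSub m := by
  subst h
  simp [MulAction.mem_stabilizer_iff, tr]

/-- The matrix entries of the induced representation:
`δ_{a, σ(b)} φ_{kl}[(a, n-1) σ (b, n-1)]` in row `(a, k)` and column `(b, l)`. -/
def indMatrix {m d : ℕ} (φ : SymSub m →* Matrix (Fin d) (Fin d) ℂ) (σ : Sym m) :
    Matrix (Fin (m + 1) × Fin d) (Fin (m + 1) × Fin d) ℂ :=
  fun r c => if h : r.1 = σ c.1 then φ ⟨tr r.1 * σ * tr c.1, conj_mem h⟩ r.2 c.2 else 0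

theorem indMatrix_pos {m d : ℕ} (φ : SymSub m →* Matrix (Fin d) (Fin d) ℂ) {σ : Sym m}
    {a b : Fin (m + 1)} (h : a = σ b) (k l : Fin d) :
    indMatrix φ σ (a, k) (b, l) = φ ⟨tr a * σ * tr b, conj_mem h⟩ k l :=
  dif_pos h

theorem indMatrix_neg {m d : ℕ} (φ : SymSub m →* Matrix (Fin d) (Fin d) ℂ) {σ : Sym m}
    {a b : Fin (m + 1)} (h : a ≠ σ b) (k l : Fin d) : indMatrix φ σ (a, k) (b, l) = 0 :=
  dif_neg h

theorem indMatrix_one {m d : ℕ} (φ : SymSub m →* Matrix (Fin d) (Fin d) ℂ) :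
    indMatrix φ 1 = 1 := by
  ext ⟨a, k⟩ ⟨b, l⟩
  by_cases h : a = b
  · subst h
    have e : (⟨tr a * 1 * tr a, conj_mem rfl⟩ : SymSub m) = 1 := by
      apply Subtype.ext
      simp [tr_mul_tr]
    have h1 : a = (1 : Sym m) a := rfl
    rw [indMatrix_pos φ h1, e, map_one]
    simp [Matrix.one_apply]
  · rw [indMatrix_neg φ (by simpa using h)]
    simp [h]

theorem indMatrix_mul {m d : ℕ} (φ : SymSub m →* Matrix (Fin d) (Fin d) ℂ) (σ τ : Sym m) :
    indMatrix φ (σ * τ) = indMatrix φ σ * indMatrix φ τ := by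
  ext ⟨a, k⟩ ⟨b, l⟩
  rw [Matrix.mul_apply, Fintype.sum_prod_type, Finset.sum_eq_single (τ b)]
  · by_cases h : a = σ (τ b)
    · have h' : a = (σ * τ) b := h
      have e : (⟨tr a * (σ * τ) * tr b, conj_mem h'⟩ : SymSub m) =
          ⟨tr a * σ * tr (τ b), conj_mem h⟩ * ⟨tr (τ b) * τ * tr b, conj_mem rfl⟩ := by
        apply Subtype.ext
        have := tr_mul_tr (τ b)
        calc tr a * (σ * τ) * tr b = tr a * σ * 1 * τ * tr b := by group
          _ = tr a * σ * (tr (τ b) * tr (τ b)) * τ * tr b := by rw [this]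
          _ = _ := by simp [mul_assoc]
      rw [indMatrix_pos φ h', e, map_mul, Matrix.mul_apply]
      exact Finset.sum_congr rfl fun j _ => by
        rw [indMatrix_pos φ h, indMatrix_pos φ rfl]
    · have h' : a ≠ (σ * τ) b := h
      rw [indMatrix_neg φ h']
      exact (Finset.sum_eq_zero fun j _ => by rw [indMatrix_neg φ h, zero_mul]).symm
  · intro c _ hc
    exact Finset.sum_eq_zero fun j _ => by rw [indMatrix_neg φ hc, mul_zero]
  · simp

/-- The representation `Φ = ind_{S(n-2)}^{S(n-1)} φ` in its standard matrix form. -/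
def ind {m d : ℕ} (φ : SymSub m →* Matrix (Fin d) (Fin d) ℂ) :
    Sym m →* Matrix (Fin (m + 1) × Fin d) (Fin (m + 1) × Fin d) ℂ where
  toFun := indMatrix φ
  map_one' := indMatrix_one φ
  map_mul' := indMatrix_mul φ

/-- A system of pairwise inequivalent matrix irreps `φ ξ` of `S(n-2)`, one for each label
`ξ`. -/
structure IrrepSystem (m : ℕ) (A : Type*) where
  dim : A → ℕ
  φ : ∀ ξ, SymSub m →* Matrix (Fin (dim ξ)) (Fin (dim ξ)) ℂ
  irreducible : ∀ ξ, (toRep (φ ξ)).IsIrreducible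
  inequivalent : ∀ ξ ζ, Nonempty ((toRep (φ ξ)).Equiv (toRep (φ ζ))) → ξ = ζ

/-- A partially reduced irreducible representation of `S(n-1)`: a unitary matrix irrep whose
restriction to `S(n-2)` is the block-diagonal matrix `⨁_ξ φ ξ`, where `ξ` runs over a finite set
of labels. Its rows and columns are indexed by pairs `(ξ, j)` with `j` an index of `φ ξ`. -/
structure PRIR {m : ℕ} {A : Type*} [DecidableEq A] (S : IrrepSystem m A) where
  blocks : Finset A
  rep : Sym m →* Matrix (Σ ξ : blocks, Fin (S.dim ξ)) (Σ ξ : blocks, Fin (S.dim ξ)) ℂ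
  unitary : ∀ σ, rep σ ∈ Matrix.unitaryGroup (Σ ξ : blocks, Fin (S.dim ξ)) ℂ
  irreducible : (toRep rep).IsIrreducible
  reduced : ∀ π : SymSub m, rep π = Matrix.blockDiagonal' (fun ξ : blocks => S.φ ξ π)

/-- The PRIR indices `(ξ, j)` of the rows and columns of a PRIR. -/
abbrev PRIR.Idx {m : ℕ} {A : Type*} [DecidableEq A] {S : IrrepSystem m A} (ψ : PRIR S) : Type _ :=
  Σ ξ : ψ.blocks, Fin (S.dim ξ)

/-- The dimension of a PRIR. -/
def PRIR.dim {m : ℕ} {A : Type*} [DecidableEq A] {S : IrrepSystem m A} (ψ : PRIR S) : ℕ :=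
  Fintype.card ψ.Idx

/-- The family `ψ` lists, each exactly once up to equivalence, the irreps of `S(n-1)` that are
contained in the representation `Φ`. -/
structure ListsConstituents {m : ℕ} {A I ι : Type*} [DecidableEq A] [Fintype ι] [DecidableEq ι]
    {S : IrrepSystem m A} (ψ : I → PRIR S) (Φ : Sym m →* Matrix ι ι ℂ) : Prop where
  inequivalent : ∀ ν μ, Nonempty ((toRep (ψ ν).rep).Equiv (toRep (ψ μ).rep)) → ν = μ
  contained : ∀ ν, ∃ f : (toRep (ψ ν).rep).IntertwiningMap (toRep Φ), Function.Injective f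
  exhaustive : ∀ W : Subrepresentation (toRep Φ), W.toRepresentation.IsIrreducible →
    ∃ ν, Nonempty (W.toRepresentation.Equiv (toRep (ψ ν).rep))

/-- The matrix `Z_R(α)`, with rows `(a, k)` and columns `(ν, (ξ, j))` and the entries
`(n-1)^{-1/2} √d_ν / √d_α · (ψ^ν)^{α ξ}_{k j}[(a, n-1)]`. -/
noncomputable def zR {m : ℕ} {A I : Type*} [DecidableEq A] {S : IrrepSystem m A}
    (ψ : I → PRIR S) (α : A) (hα : ∀ ν, α ∈ (ψ ν).blocks) :
    Matrix (Fin (m + 1) × Fin (S.dim α)) (Σ ν : I, (ψ ν).Idx) ℂ :=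
  fun r c => ((1 / √((m + 1 : ℕ) : ℝ) * (√((ψ c.1).dim : ℝ) / √(S.dim α : ℝ)) : ℝ) : ℂ) *
    (ψ c.1).rep (tr r.1) ⟨⟨α, hα c.1⟩, r.2⟩ c.2

/-- The matrix `W` is unitary and reduces `Φ` into the direct sum of the representations
`ψ ν`. -/
def UnitarilyReduces {m : ℕ} {A I ι : Type*} [DecidableEq A] [Fintype I] [DecidableEq I]
    [Fintype ι] [DecidableEq ι] {S : IrrepSystem m A} (ψ : I → PRIR S)
    (W : Matrix ι (Σ ν : I, (ψ ν).Idx) ℂ) (Φ : Sym m →* Matrix ι ι ℂ) : Prop :=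
  Wᴴ * W = 1 ∧ W * Wᴴ = 1 ∧
    ∀ σ : Sym m, Wᴴ * Φ σ * W = Matrix.blockDiagonal' (fun ν : I => (ψ ν).rep σ)

end PRIRep

/-!
Write `Φ` for the representation induced from `φ α`, and let `zBlock` be the block of columns of
`zR` that belongs to one PRIR `ψ`. The proof is Frobenius reciprocity in matrix form, combined with
Schur's lemma.

* An intertwiner `F` from `ψ` to `Φ` is determined by its rows at the last point, through
  `F (a, k) = F (last, k) * ψ (tr a)` (`PRIR.apply_eq_of_intertwines`). These rows intertwine the
  restriction of `ψ` to `S(n-2)` with `φ α`. The restriction is block diagonal with pairwise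
  inequivalent blocks, so by Schur's lemma they form a multiple of the projection to the block `α`
  (`PRIR.eq_smul_of_restriction_intertwines`). Hence `F` vanishes if `α` is not a label of `ψ`
  (`PRIR.eq_zero_of_notMem_blocks`), and is a multiple of `zBlock` otherwise
  (`PRIR.eq_smul_zBlock`). In particular `α` is a label of every constituent of `Φ`.

* Conversely `zBlock` is an intertwiner (`PRIR.ind_mul_zBlock`). Since `ψ` and `Φ` are unitary, the
  products of adjoints of blocks with blocks intertwine the constituents, so Schur's lemma makes
  them zero or scalar, and a trace gives the scalar `1` (`PRIR.gram_self`, `PRIR.gram_eq_zero`).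
  Thus the columns of `zR` are orthonormal.

* The kernel of the adjoint of `zR` is a subrepresentation of `Φ`. If it were nonzero, it would
  contain an irreducible one, which is the image of some constituent under a multiple of a block of
  `zR`; but the adjoint of `zR` is injective on the range of `zR`
  (`mulVec_conjTranspose_zR_injective`). So `zR` is unitary.

* If `W` is any reducing unitary matrix, its blocks of columns are intertwiners too, hence multiples
  of those of `zR`, and orthonormality forces the factors to have modulus one (`exists_phase`).
-/

namespace PRIRep

/-! ### Schur's lemma for matrix representations -/

section Schur

variable {G ι κ : Type*} [Monoid G] [Fintype ι] [DecidableEq ι] [Fintype κ] [DecidableEq κ]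

/-- The intertwining map given by a matrix that intertwines two matrix representations. -/
noncomputable def matrixIntertwiner (ρ : G →* Matrix ι ι ℂ) (τ : G →* Matrix κ κ ℂ)
    (F : Matrix κ ι ℂ) (h : ∀ g, F * ρ g = τ g * F) :
    (toRep ρ).IntertwiningMap (toRep τ) where
  toLinearMap := Matrix.toLin' F
  isIntertwining' g := by
    refine LinearMap.ext fun v => ?_
    change F *ᵥ (ρ g *ᵥ v) = τ g *ᵥ (F *ᵥ v)
    rw [Matrix.mulVec_mulVec, Matrix.mulVec_mulVec, h]

theorem eq_zero_of_intertwines {ρ : G →* Matrix ι ι ℂ} {τ : G →* Matrix κ κ ℂ}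
    (hρ : (toRep ρ).IsIrreducible) (hτ : (toRep τ).IsIrreducible)
    (hne : ¬ Nonempty ((toRep ρ).Equiv (toRep τ)))
    {F : Matrix κ ι ℂ} (h : ∀ g, F * ρ g = τ g * F) : F = 0 := by
  rcases Representation.IsIrreducible.bijective_or_eq_zero (matrixIntertwiner ρ τ F h) with hb | h0
  · exact (hne ⟨(matrixIntertwiner ρ τ F h).ofBijective hb⟩).elim
  · have : Matrix.toLin' F = 0 := congrArg (·.toLinearMap) h0
    simpa using this

theorem eq_smul_one_of_commutes {ρ : G →* Matrix ι ι ℂ} (hρ : (toRep ρ).IsIrreducible)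
    {F : Matrix ι ι ℂ} (h : ∀ g, F * ρ g = ρ g * F) : ∃ c : ℂ, F = c • 1 := by
  obtain ⟨c, hc⟩ :=
    (Representation.IsIrreducible.algebraMap_intertwiningMap_bijective_of_isAlgClosed).2
      (matrixIntertwiner ρ ρ F h)
  have h1 : c • LinearMap.id = Matrix.toLin' F := congrArg (·.toLinearMap) hc
  refine ⟨c, Matrix.toLin'.injective ?_⟩
  rw [← h1, map_smul, Matrix.toLin'_one]

theorem nonempty_of_isIrreducible {ρ : G →* Matrix ι ι ℂ} (hρ : (toRep ρ).IsIrreducible) :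
    Nonempty ι := by
  by_contra h
  rw [not_nonempty_iff] at h
  refine (bot_ne_top : (⊥ : Subrepresentation (toRep ρ)) ≠ ⊤) ?_
  exact Subrepresentation.toSubmodule_injective (Subsingleton.elim _ _)

theorem toMatrix'_intertwines {ρ : G →* Matrix ι ι ℂ} {τ : G →* Matrix κ κ ℂ}
    (f : (toRep ρ).IntertwiningMap (toRep τ)) (g : G) :
    LinearMap.toMatrix' f.toLinearMap * ρ g = τ g * LinearMap.toMatrix' f.toLinearMap := by
  apply Matrix.toLin'.injective
  rw [Matrix.toLin'_mul, Matrix.toLin'_mul, Matrix.toLin'_toMatrix']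
  exact f.isIntertwining' g

/-- A nonzero finite-dimensional representation contains an irreducible one. -/
theorem exists_isIrreducible_le {V : Type*} [AddCommGroup V] [Module ℂ V] [FiniteDimensional ℂ V]
    {ρ : Representation ℂ G V} {U : Subrepresentation ρ} (hU : U ≠ ⊥) :
    ∃ W ≤ U, W.toRepresentation.IsIrreducible := by
  have hwf : WellFounded ((· < ·) : Subrepresentation ρ → Subrepresentation ρ → Prop) :=
    Subrelation.wf (fun {a b} (h : a < b) => show a.toSubmodule < b.toSubmodule from h)
      (InvImage.wf Subrepresentation.toSubmodule wellFounded_lt)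
  have := isAtomic_of_orderBot_wellFounded_lt hwf
  obtain ⟨W, hW, hWU⟩ := (IsAtomic.eq_bot_or_exists_atom_le U).resolve_left hU
  refine ⟨W, hWU, ?_⟩
  have hne : (⊥ : Subrepresentation W.toRepresentation) ≠ ⊤ := by
    intro h
    apply hW.1
    refine le_bot_iff.1 fun v hv => ?_
    have h1 : (⟨v, hv⟩ : W.toSubmodule) ∈ (⊤ : Subrepresentation W.toRepresentation) :=
      Submodule.mem_top
    rw [← h] at h1
    have h2 : (⟨v, hv⟩ : W.toSubmodule) = 0 := h1
    exact congrArg Subtype.val h2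
  have : Nontrivial (Subrepresentation W.toRepresentation) := ⟨_, _, hne⟩
  refine ⟨fun X => ?_⟩
  -- a subrepresentation `X` of the atom `W`, seen inside `ρ`, is `⊥` or `W`
  let Y : Subrepresentation ρ :=
    { toSubmodule := X.toSubmodule.map W.toSubmodule.subtype
      apply_mem_toSubmodule := by
        rintro g _ ⟨x, hx, rfl⟩
        exact ⟨W.toRepresentation g x, X.apply_mem_toSubmodule g hx, rfl⟩ }
  have hYW : Y ≤ W := by
    rintro _ ⟨x, -, rfl⟩
    exact x.2
  rcases hW.le_iff.1 hYW with h | h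
  · left
    refine le_bot_iff.1 fun x hx => ?_
    have h1 : (x : V) ∈ Y := ⟨x, hx, rfl⟩
    rw [h] at h1
    exact Subtype.ext h1
  · right
    refine top_le_iff.1 fun x _ => ?_
    have h1 : (x : V) ∈ Y := by
      rw [h]
      exact x.2
    obtain ⟨y, hy, hyx⟩ := h1
    rwa [← Subtype.ext hyx]

end Schur

theorem IrrepSystem.dim_pos {m : ℕ} {A : Type*} (S : IrrepSystem m A) (α : A) : 0 < S.dim α :=
  Fin.pos_iff_nonempty.2 (nonempty_of_isIrreducible (S.irreducible α))

/-! ### Intertwiners from a PRIR to the induced representation -/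

variable {m : ℕ} {A : Type*} [DecidableEq A] {S : IrrepSystem m A}

namespace PRIR

variable (ψ : PRIR S) {α : A}

theorem conjTranspose_rep (σ : Sym m) : (ψ.rep σ)ᴴ = ψ.rep σ⁻¹ := by
  have h : (ψ.rep σ)ᴴ * ψ.rep σ = 1 := Matrix.mem_unitaryGroup_iff'.1 (ψ.unitary σ)
  calc (ψ.rep σ)ᴴ = (ψ.rep σ)ᴴ * (ψ.rep σ * ψ.rep σ⁻¹) := by
        rw [← map_mul, mul_inv_cancel, map_one, mul_one]
    _ = ψ.rep σ⁻¹ := by rw [← mul_assoc, h, one_mul]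

theorem rep_apply_same (hα : α ∈ ψ.blocks) (π : SymSub m) (k l : Fin (S.dim α)) :
    ψ.rep π ⟨⟨α, hα⟩, k⟩ ⟨⟨α, hα⟩, l⟩ = S.φ α π k l := by
  rw [ψ.reduced, Matrix.blockDiagonal'_apply_eq]

/-- Every irrep of the subgroup that occurs in a PRIR is unitary. -/
theorem conjTranspose_phi (hα : α ∈ ψ.blocks) (π : SymSub m) : (S.φ α π)ᴴ = S.φ α π⁻¹ := by
  ext k l
  rw [Matrix.conjTranspose_apply, ← ψ.rep_apply_same hα, ← ψ.rep_apply_same hα, Subgroup.coe_inv,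
    ← conjTranspose_rep, Matrix.conjTranspose_apply]

theorem rep_coe_mul_rep_apply (hα : α ∈ ψ.blocks) (π : SymSub m) (τ : Sym m) (k : Fin (S.dim α))
    (x : ψ.Idx) : ψ.rep (π * τ) ⟨⟨α, hα⟩, k⟩ x =
      ∑ l, S.φ α π k l * ψ.rep τ ⟨⟨α, hα⟩, l⟩ x := by
  rw [map_mul, Matrix.mul_apply, Fintype.sum_sigma, Finset.sum_eq_single ⟨α, hα⟩]
  · simp_rw [rep_apply_same]
  · intro ξ _ hξ
    refine Finset.sum_eq_zero fun j _ => ?_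
    rw [ψ.reduced, Matrix.blockDiagonal'_apply_ne _ _ _ hξ.symm, zero_mul]
  · simp

/-- The block of columns of `zR` that belongs to the PRIR `ψ`. -/
noncomputable def zBlock (hα : α ∈ ψ.blocks) : Matrix (Fin (m + 1) × Fin (S.dim α)) ψ.Idx ℂ :=
  fun r x => ((1 / √((m + 1 : ℕ) : ℝ) * (√(ψ.dim : ℝ) / √(S.dim α : ℝ)) : ℝ) : ℂ) *
    ψ.rep (tr r.1) ⟨⟨α, hα⟩, r.2⟩ x

theorem ind_mul_zBlock (hα : α ∈ ψ.blocks) (σ : Sym m) :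
    ind (S.φ α) σ * ψ.zBlock hα = ψ.zBlock hα * ψ.rep σ := by
  ext ⟨a, k⟩ x
  obtain ⟨b, rfl⟩ := σ.surjective a
  -- `tr (σ b) * σ * tr b` fixes the last point, so it acts on the rows `α` of `ψ` through `φ α`
  have e : tr (σ b) * σ =
      ((⟨tr (σ b) * σ * tr b, conj_mem rfl⟩ : SymSub m) : Sym m) * tr b := by
    simp [mul_assoc, tr_mul_tr]
  have h1 : (ψ.zBlock hα * ψ.rep σ) (σ b, k) x =
      ((1 / √((m + 1 : ℕ) : ℝ) * (√(ψ.dim : ℝ) / √(S.dim α : ℝ)) : ℝ) : ℂ) *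
        ψ.rep (tr (σ b) * σ) ⟨⟨α, hα⟩, k⟩ x := by
    rw [map_mul, Matrix.mul_apply, Matrix.mul_apply, Finset.mul_sum]
    exact Finset.sum_congr rfl fun y _ => mul_assoc _ _ _
  rw [h1, e, rep_coe_mul_rep_apply, Matrix.mul_apply, Fintype.sum_prod_type,
    Finset.sum_eq_single b, Finset.mul_sum]
  · refine Finset.sum_congr rfl fun l _ => ?_
    change indMatrix _ _ _ _ * _ = _
    rw [indMatrix_pos _ rfl]
    exact mul_left_comm _ _ _
  · intro c _ hc
    refine Finset.sum_eq_zero fun l _ => ?_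
    change indMatrix _ _ _ _ * _ = _
    rw [indMatrix_neg _ (fun h => hc (σ.injective h).symm), zero_mul]
  · simp

/-- Schur's lemma for the restriction of a PRIR to the subgroup: a label occurs at most once in a
PRIR, so an intertwiner from the restriction to `φ α` vanishes or is, up to a scalar, the
projection to the block `α`. -/
theorem eq_smul_of_restriction_intertwines {G : Matrix (Fin (S.dim α)) ψ.Idx ℂ}
    (hG : ∀ π : SymSub m, G * ψ.rep π = S.φ α π * G) :
    (α ∉ ψ.blocks → G = 0) ∧
      ∀ hα : α ∈ ψ.blocks, ∃ c : ℂ, ∀ k x,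
        G k x = c * (1 : Matrix ψ.Idx ψ.Idx ℂ) ⟨⟨α, hα⟩, k⟩ x := by
  have hblock : ∀ (ξ : ψ.blocks) (π : SymSub m),
      (Matrix.of fun k j => G k ⟨ξ, j⟩) * S.φ ξ π =
        S.φ α π * (Matrix.of fun k j => G k ⟨ξ, j⟩) := by
    intro ξ π
    ext k j
    have h := congrFun (congrFun (hG π) k) ⟨ξ, j⟩
    rw [Matrix.mul_apply, Fintype.sum_sigma, Finset.sum_eq_single ξ] at h
    · rw [Matrix.mul_apply, Matrix.mul_apply]
      simpa [ψ.reduced, Matrix.blockDiagonal'_apply_eq, Matrix.mul_apply] using h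
    · intro ζ _ hζ
      refine Finset.sum_eq_zero fun i _ => ?_
      rw [ψ.reduced, Matrix.blockDiagonal'_apply_ne _ _ _ hζ, mul_zero]
    · simp
  have hzero : ∀ ξ : ψ.blocks, (ξ : A) ≠ α → ∀ k j, G k ⟨ξ, j⟩ = 0 := by
    intro ξ hξ k j
    have h := eq_zero_of_intertwines (S.irreducible ξ) (S.irreducible α)
      (fun h => hξ (S.inequivalent _ _ h)) (hblock ξ)
    exact congrFun (congrFun h k) j
  refine ⟨fun hα => ?_, fun hα => ?_⟩
  · ext k ⟨ξ, j⟩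
    exact hzero ξ (fun h => hα (h ▸ ξ.2)) k j
  · obtain ⟨c, hc⟩ := eq_smul_one_of_commutes (S.irreducible α) (hblock ⟨α, hα⟩)
    refine ⟨c, fun k ⟨ξ, j⟩ => ?_⟩
    by_cases hξ : (ξ : A) = α
    · obtain ⟨ξ, hξ'⟩ := ξ
      dsimp only at hξ
      subst hξ
      have h := congrFun (congrFun hc k) j
      simpa [Matrix.one_apply] using h
    · rw [hzero ξ hξ, Matrix.one_apply_ne, mul_zero]
      intro h
      exact hξ (congrArg (fun y : ψ.Idx => (y.1 : A)) h).symm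

/-- An intertwiner into the induced representation is determined by its rows at the last
point. -/
theorem apply_eq_of_intertwines {F : Matrix (Fin (m + 1) × Fin (S.dim α)) ψ.Idx ℂ}
    (hF : ∀ σ, F * ψ.rep σ = ind (S.φ α) σ * F) (a : Fin (m + 1)) (k : Fin (S.dim α))
    (x : ψ.Idx) : F (a, k) x = ∑ y, F (Fin.last m, k) y * ψ.rep (tr a) y x := by
  -- compare the rows at the last point of the two sides of `hF (tr a)`
  have ha : Fin.last m = tr a a := by simp [tr]
  have e : (⟨tr (Fin.last m) * tr a * tr a, conj_mem ha⟩ : SymSub m) = 1 := by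
    apply Subtype.ext
    simp only [mul_assoc, tr_mul_tr, mul_one]
    exact Equiv.swap_self _
  have h := congrFun (congrFun (hF (tr a)) (Fin.last m, k)) x
  rw [Matrix.mul_apply, Matrix.mul_apply, Fintype.sum_prod_type, Finset.sum_eq_single a] at h
  · rw [h, Finset.sum_eq_single k]
    · change _ = indMatrix _ _ _ _ * _
      rw [indMatrix_pos _ ha, e]
      simp
    · intro l _ hl
      change indMatrix _ _ _ _ * _ = 0
      rw [indMatrix_pos _ ha, e, map_one, Matrix.one_apply_ne hl.symm, zero_mul]
    · simp
  · intro b _ hb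
    refine Finset.sum_eq_zero fun l _ => ?_
    change indMatrix _ _ _ _ * _ = 0
    rw [indMatrix_neg _ (fun h => hb ((tr a).injective (ha.symm.trans h)).symm), zero_mul]
  · simp

/-- The rows at the last point of an intertwiner from `ψ` to the induced representation
intertwine the restriction of `ψ` to the subgroup with `φ α`. -/
theorem lastRows_intertwines {F : Matrix (Fin (m + 1) × Fin (S.dim α)) ψ.Idx ℂ}
    (hF : ∀ σ, F * ψ.rep σ = ind (S.φ α) σ * F) (π : SymSub m) :
    (Matrix.of fun k x => F (Fin.last m, k) x) * ψ.rep π =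
      S.φ α π * Matrix.of fun k x => F (Fin.last m, k) x := by
  have hπ : Fin.last m = (π : Sym m) (Fin.last m) := (MulAction.mem_stabilizer_iff.1 π.2).symm
  have e : (⟨tr (Fin.last m) * π * tr (Fin.last m), conj_mem hπ⟩ : SymSub m) = π := by
    apply Subtype.ext
    have h1 : tr (Fin.last m) = 1 := Equiv.swap_self _
    simp only [h1, one_mul, mul_one]
  ext k x
  have h := congrFun (congrFun (hF π) (Fin.last m, k)) x
  rw [Matrix.mul_apply, Matrix.mul_apply, Fintype.sum_prod_type,
    Finset.sum_eq_single (Fin.last m)] at h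
  · rw [Matrix.mul_apply, Matrix.mul_apply]
    refine h.trans (Finset.sum_congr rfl fun l _ => ?_)
    change indMatrix _ _ _ _ * _ = _
    rw [indMatrix_pos _ hπ, e]
    rfl
  · intro b _ hb
    refine Finset.sum_eq_zero fun l _ => ?_
    change indMatrix _ _ _ _ * _ = 0
    rw [indMatrix_neg _ (fun h => hb ((π : Sym m).injective (hπ.symm.trans h)).symm), zero_mul]
  · simp

theorem eq_zero_of_notMem_blocks (hα : α ∉ ψ.blocks)
    {F : Matrix (Fin (m + 1) × Fin (S.dim α)) ψ.Idx ℂ}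
    (hF : ∀ σ, F * ψ.rep σ = ind (S.φ α) σ * F) : F = 0 := by
  have h0 := (ψ.eq_smul_of_restriction_intertwines (ψ.lastRows_intertwines hF)).1 hα
  ext ⟨a, k⟩ x
  rw [ψ.apply_eq_of_intertwines hF]
  refine Finset.sum_eq_zero fun y _ => ?_
  rw [show F (Fin.last m, k) y = 0 from congrFun (congrFun h0 k) y, zero_mul]

theorem nonempty_idx : Nonempty ψ.Idx := nonempty_of_isIrreducible ψ.irreducible

theorem dim_pos : 0 < ψ.dim := Fintype.card_pos_iff.2 ψ.nonempty_idx

theorem zBlock_const_pos (α : A) :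
    0 < 1 / √((m + 1 : ℕ) : ℝ) * (√(ψ.dim : ℝ) / √(S.dim α : ℝ)) := by
  have h1 : (0 : ℝ) < ψ.dim := by exact_mod_cast ψ.dim_pos
  have h2 : (0 : ℝ) < S.dim α := by exact_mod_cast S.dim_pos α
  positivity

/-- Multiplicity one: `zBlock` spans the space of intertwiners from a PRIR to the induced
representation. -/
theorem eq_smul_zBlock (hα : α ∈ ψ.blocks) {F : Matrix (Fin (m + 1) × Fin (S.dim α)) ψ.Idx ℂ}
    (hF : ∀ σ, F * ψ.rep σ = ind (S.φ α) σ * F) : ∃ c : ℂ, F = c • ψ.zBlock hα := by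
  obtain ⟨c, hc⟩ := (ψ.eq_smul_of_restriction_intertwines (ψ.lastRows_intertwines hF)).2 hα
  have hpos := ψ.zBlock_const_pos α
  have hne : ((1 / √((m + 1 : ℕ) : ℝ) * (√(ψ.dim : ℝ) / √(S.dim α : ℝ)) : ℝ) : ℂ) ≠ 0 :=
    Complex.ofReal_ne_zero.2 hpos.ne'
  refine ⟨c / ((1 / √((m + 1 : ℕ) : ℝ) * (√(ψ.dim : ℝ) / √(S.dim α : ℝ)) : ℝ) : ℂ), ?_⟩
  ext ⟨a, k⟩ x
  have h1 : F (a, k) x = c * ψ.rep (tr a) ⟨⟨α, hα⟩, k⟩ x := by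
    rw [ψ.apply_eq_of_intertwines hF]
    have hc' : ∀ y, F (Fin.last m, k) y = _ := hc k
    simp_rw [hc', mul_assoc, ← Finset.mul_sum, ← Matrix.mul_apply, one_mul]
  rw [h1, Matrix.smul_apply, smul_eq_mul, zBlock, ← mul_assoc, div_mul_cancel₀ _ hne]

/-! ### Unitarity and the Gram matrices of the blocks -/

/-- The induced representation is unitary; the PRIR `ψ` serves to make `φ α` unitary. -/
theorem conjTranspose_ind (hα : α ∈ ψ.blocks) (σ : Sym m) :
    (ind (S.φ α) σ)ᴴ = ind (S.φ α) σ⁻¹ := by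
  ext ⟨a, k⟩ ⟨b, l⟩
  rw [Matrix.conjTranspose_apply]
  change star (indMatrix _ _ _ _) = indMatrix _ _ _ _
  by_cases h : b = σ a
  · have h' : a = σ⁻¹ b := by simp [h]
    rw [indMatrix_pos _ h, indMatrix_pos _ h', ← Matrix.conjTranspose_apply,
      ψ.conjTranspose_phi hα]
    -- the inverse of `tr b * σ * tr a` is `tr a * σ⁻¹ * tr b`, since each `tr` is an involution
    congr 2
  · have h' : a ≠ σ⁻¹ b := fun h' => h (by simp [h'])
    rw [indMatrix_neg _ h, indMatrix_neg _ h', star_zero]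

theorem conjTranspose_zBlock_mul_ind (hα : α ∈ ψ.blocks) (σ : Sym m) :
    (ψ.zBlock hα)ᴴ * ind (S.φ α) σ = ψ.rep σ * (ψ.zBlock hα)ᴴ := by
  have h := congrArg Matrix.conjTranspose (ψ.ind_mul_zBlock hα σ⁻¹)
  rwa [Matrix.conjTranspose_mul, Matrix.conjTranspose_mul, ψ.conjTranspose_ind hα,
    ψ.conjTranspose_rep, inv_inv] at h

theorem gram_intertwines (χ : PRIR S) (hα : α ∈ ψ.blocks) (hα' : α ∈ χ.blocks) (σ : Sym m) :
    (ψ.zBlock hα)ᴴ * χ.zBlock hα' * χ.rep σ = ψ.rep σ * ((ψ.zBlock hα)ᴴ * χ.zBlock hα') := by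
  rw [Matrix.mul_assoc, ← ind_mul_zBlock, ← Matrix.mul_assoc, conjTranspose_zBlock_mul_ind,
    Matrix.mul_assoc]

/-- The columns of `zBlock` are orthonormal: by Schur's lemma their Gram matrix is scalar, and its
trace is a sum of squared norms of rows of unitary matrices. -/
theorem gram_self (hα : α ∈ ψ.blocks) : (ψ.zBlock hα)ᴴ * ψ.zBlock hα = 1 := by
  obtain ⟨c, hc⟩ := eq_smul_one_of_commutes ψ.irreducible (ψ.gram_intertwines ψ hα hα)
  have hrow : ∀ a k, ∑ x, ψ.rep (tr a) ⟨⟨α, hα⟩, k⟩ x * star (ψ.rep (tr a) ⟨⟨α, hα⟩, k⟩ x) = 1 := by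
    intro a k
    have h : ψ.rep (tr a) * (ψ.rep (tr a))ᴴ = 1 := Matrix.mem_unitaryGroup_iff.1 (ψ.unitary _)
    have h1 := congrFun (congrFun h ⟨⟨α, hα⟩, k⟩) ⟨⟨α, hα⟩, k⟩
    rwa [Matrix.mul_apply, Matrix.one_apply_eq] at h1
  have h1 : (ψ.dim : ℝ) ≠ 0 := by exact_mod_cast ψ.dim_pos.ne'
  have h2 : (S.dim α : ℝ) ≠ 0 := by exact_mod_cast (S.dim_pos α).ne'
  have h3 : ((m + 1 : ℕ) : ℝ) ≠ 0 := by positivity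
  have hq : (1 / √((m + 1 : ℕ) : ℝ) * (√(ψ.dim : ℝ) / √(S.dim α : ℝ))) ^ 2 =
      ψ.dim / ((m + 1 : ℕ) * S.dim α) := by
    rw [mul_pow, div_pow, div_pow, Real.sq_sqrt (Nat.cast_nonneg _),
      Real.sq_sqrt (Nat.cast_nonneg _), Real.sq_sqrt (Nat.cast_nonneg _), one_pow, div_mul_div_comm,
      one_mul]
  have htr : Matrix.trace ((ψ.zBlock hα)ᴴ * ψ.zBlock hα) = ψ.dim := by
    -- in the other order every diagonal entry is a multiple of the squared norm of a row of `ψ`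
    rw [Matrix.trace_mul_comm, Matrix.trace]
    have h : ∀ r, Matrix.diag (ψ.zBlock hα * (ψ.zBlock hα)ᴴ) r =
        (((ψ.dim : ℝ) / ((m + 1 : ℕ) * S.dim α) : ℝ) : ℂ) := by
      intro r
      rw [Matrix.diag_apply, Matrix.mul_apply, ← hq]
      rw [← mul_one (Complex.ofReal _), ← hrow r.1 r.2, Finset.mul_sum]
      refine Finset.sum_congr rfl fun x _ => ?_
      simp only [zBlock, Matrix.conjTranspose_apply, star_mul', Complex.star_def,
        Complex.conj_ofReal]
      rw [Complex.ofReal_pow]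
      ring
    rw [Finset.sum_congr rfl fun r _ => h r, Finset.sum_const, Finset.card_univ,
      Fintype.card_prod, Fintype.card_fin, Fintype.card_fin, nsmul_eq_mul]
    have : (((m + 1) * S.dim α : ℕ) : ℝ) * ((ψ.dim : ℝ) / ((m + 1 : ℕ) * S.dim α)) = ψ.dim := by
      rw [Nat.cast_mul]
      field_simp
    exact_mod_cast this
  rw [hc, Matrix.trace_smul, Matrix.trace_one, smul_eq_mul] at htr
  have hc1 : c = 1 := by
    refine mul_right_cancel₀ (b := (ψ.dim : ℂ)) (by exact_mod_cast h1) ?_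
    rw [one_mul]
    exact htr
  rw [hc, hc1, one_smul]

theorem gram_eq_zero {ψ χ : PRIR S} (hα : α ∈ ψ.blocks) (hα' : α ∈ χ.blocks)
    (hne : ¬ Nonempty ((toRep χ.rep).Equiv (toRep ψ.rep))) :
    (ψ.zBlock hα)ᴴ * χ.zBlock hα' = 0 :=
  eq_zero_of_intertwines χ.irreducible ψ.irreducible hne (ψ.gram_intertwines χ hα hα')

end PRIR

/-! ### The reducing matrix -/

section Reduction

variable {I ι : Type*} [Fintype ι] [DecidableEq ι]
  {ψ : I → PRIR S} {Φ : Sym m →* Matrix ι ι ℂ}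

/-- If a family exhausts the irreps contained in `Φ`, every nonzero subrepresentation of `Φ`
contains the image of an embedding of a member of the family. -/
theorem ListsConstituents.exists_embedding (hψ : ListsConstituents ψ Φ)
    {U : Subrepresentation (toRep Φ)} (hU : U ≠ ⊥) :
    ∃ ν, ∃ F : Matrix ι (ψ ν).Idx ℂ, F ≠ 0 ∧ (∀ σ, F * (ψ ν).rep σ = Φ σ * F) ∧
      ∀ v, F *ᵥ v ∈ U := by
  obtain ⟨W, hWU, hW⟩ := exists_isIrreducible_le hU
  obtain ⟨ν, ⟨e⟩⟩ := hψ.exhaustive W hW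
  let f : (toRep (ψ ν).rep).IntertwiningMap (toRep Φ) :=
    { toLinearMap := W.toSubmodule.subtype ∘ₗ e.symm.toLinearMap
      isIntertwining' := fun g => LinearMap.ext fun v =>
        congrArg Subtype.val (LinearMap.congr_fun (e.symm.isIntertwining' g) v) }
  refine ⟨ν, LinearMap.toMatrix' f.toLinearMap, ?_, toMatrix'_intertwines f, fun v => ?_⟩
  · intro h0
    have h1 : f.toLinearMap = 0 := by simpa using h0
    obtain ⟨x⟩ := (ψ ν).nonempty_idx
    have h2 : ((e.symm (Pi.single x 1) : W.toSubmodule) : ι → ℂ) = 0 :=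
      LinearMap.congr_fun h1 (Pi.single x 1)
    have h3 : e.symm (Pi.single x 1) = e.symm 0 := by
      rw [map_zero]
      exact Subtype.ext h2
    have h4 := congrFun (e.symm.toLinearEquiv.injective h3) x
    simp at h4
  · rw [LinearMap.toMatrix'_mulVec]
    exact hWU (e.symm v).2

variable {α : A}

theorem ListsConstituents.mem_blocks (hψ : ListsConstituents ψ (ind (S.φ α))) (ν : I) :
    α ∈ (ψ ν).blocks := by
  by_contra hα
  obtain ⟨f, hf⟩ := hψ.contained ν
  have h0 : f.toLinearMap = 0 := by
    simpa using (ψ ν).eq_zero_of_notMem_blocks hα (toMatrix'_intertwines f)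
  obtain ⟨x⟩ := (ψ ν).nonempty_idx
  have h1 : f (Pi.single x 1) = f 0 := by
    rw [map_zero]
    exact LinearMap.congr_fun h0 _
  have h2 := congrFun (hf h1) x
  simp at h2

/-- The adjoint of `zR` is injective: an irrep in its kernel would be embedded by a multiple of a
block of `zR`, whose columns are orthonormal. -/
theorem mulVec_conjTranspose_zR_injective (hψ : ListsConstituents ψ (ind (S.φ α)))
    (hα : ∀ ν, α ∈ (ψ ν).blocks) {v : Fin (m + 1) × Fin (S.dim α) → ℂ}
    (hv : (zR ψ α hα)ᴴ *ᵥ v = 0) : v = 0 := by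
  let U : Subrepresentation (toRep (ind (S.φ α))) :=
    { toSubmodule := LinearMap.ker (Matrix.toLin' (zR ψ α hα)ᴴ)
      apply_mem_toSubmodule := fun σ w hw => by
        rw [LinearMap.mem_ker, Matrix.toLin'_apply] at hw ⊢
        ext ⟨ν, x⟩
        have h1 : ((ψ ν).zBlock (hα ν))ᴴ *ᵥ w = 0 := funext fun y => congrFun hw ⟨ν, y⟩
        have h2 : ((ψ ν).zBlock (hα ν))ᴴ *ᵥ (ind (S.φ α) σ *ᵥ w) = 0 := by
          rw [Matrix.mulVec_mulVec, PRIR.conjTranspose_zBlock_mul_ind, ← Matrix.mulVec_mulVec, h1,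
            Matrix.mulVec_zero]
        exact congrFun h2 x }
  by_contra hv0
  have hU : U ≠ ⊥ := by
    intro h
    have : v ∈ U := LinearMap.mem_ker.2 (by rwa [Matrix.toLin'_apply])
    rw [h] at this
    exact hv0 this
  obtain ⟨ν, F, hF0, hF, hFU⟩ := hψ.exists_embedding hU
  obtain ⟨c, hc⟩ := (ψ ν).eq_smul_zBlock (hα ν) hF
  have h1 : ((ψ ν).zBlock (hα ν))ᴴ * F = 0 := by
    apply Matrix.toLin'.injective
    ext1 x
    ext1
    ext y
    have h2 : (zR ψ α hα)ᴴ *ᵥ (F *ᵥ Pi.single x 1) = 0 := LinearMap.mem_ker.1 (hFU _)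
    have h3 := congrFun h2 ⟨ν, y⟩
    simp only [LinearMap.coe_comp, Function.comp_apply, LinearMap.coe_single, Matrix.toLin'_apply]
    rw [← Matrix.mulVec_mulVec, Matrix.zero_mulVec]
    exact h3
  apply hF0
  calc F = F * (((ψ ν).zBlock (hα ν))ᴴ * (ψ ν).zBlock (hα ν)) := by
        rw [PRIR.gram_self, Matrix.mul_one]
    _ = 0 := by
        rw [hc, Matrix.mul_smul, PRIR.gram_self] at h1
        rw [PRIR.gram_self, Matrix.mul_one, hc, ← Matrix.mul_one (c • _), Matrix.smul_mul,
          ← Matrix.mul_smul, h1, Matrix.mul_zero]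

variable [DecidableEq I]

theorem conjTranspose_zR_mul_zR (hψ : ListsConstituents ψ (ind (S.φ α)))
    (hα : ∀ ν, α ∈ (ψ ν).blocks) : (zR ψ α hα)ᴴ * zR ψ α hα = 1 := by
  ext ⟨ν, x⟩ ⟨μ, y⟩
  change (((ψ ν).zBlock (hα ν))ᴴ * (ψ μ).zBlock (hα μ)) x y = _
  by_cases h : ν = μ
  · subst h
    rw [PRIR.gram_self]
    simp [Matrix.one_apply]
  · rw [PRIR.gram_eq_zero _ _ fun e => h (hψ.inequivalent _ _ e).symm, Matrix.one_apply_ne]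
    · rfl
    · intro e
      exact h (congrArg Sigma.fst e)

variable [Fintype I]

theorem mul_eq_mul_blockDiagonal'_iff (W : Matrix ι (Σ ν, (ψ ν).Idx) ℂ) (σ : Sym m) :
    Φ σ * W = W * Matrix.blockDiagonal' (fun ν => (ψ ν).rep σ) ↔
      ∀ ν, (Matrix.of fun r x => W r ⟨ν, x⟩) * (ψ ν).rep σ =
        Φ σ * Matrix.of fun r x => W r ⟨ν, x⟩ := by
  have key : ∀ r ν x, (W * Matrix.blockDiagonal' (fun ν => (ψ ν).rep σ)) r ⟨ν, x⟩ =
      ((Matrix.of fun r x => W r ⟨ν, x⟩) * (ψ ν).rep σ) r x := by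
    intro r ν x
    rw [Matrix.mul_apply, Fintype.sum_sigma, Finset.sum_eq_single ν]
    · simp only [Matrix.blockDiagonal'_apply_eq]
      rfl
    · intro μ _ hμ
      refine Finset.sum_eq_zero fun j _ => ?_
      rw [Matrix.blockDiagonal'_apply_ne _ _ _ hμ, mul_zero]
    · simp
  constructor
  · intro h ν
    ext r x
    rw [← key, ← h]
    rfl
  · intro h
    ext r ⟨ν, x⟩
    rw [key, h]
    rfl

theorem ind_mul_zR (hα : ∀ ν, α ∈ (ψ ν).blocks) (σ : Sym m) :
    ind (S.φ α) σ * zR ψ α hα = zR ψ α hα * Matrix.blockDiagonal' (fun ν => (ψ ν).rep σ) :=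
  (mul_eq_mul_blockDiagonal'_iff _ _).2 fun ν => ((ψ ν).ind_mul_zBlock (hα ν) σ).symm

theorem zR_mul_conjTranspose_zR (hψ : ListsConstituents ψ (ind (S.φ α)))
    (hα : ∀ ν, α ∈ (ψ ν).blocks) : zR ψ α hα * (zR ψ α hα)ᴴ = 1 := by
  rw [← sub_eq_zero]
  apply Matrix.toLin'.injective
  refine LinearMap.ext fun v => ?_
  rw [Matrix.toLin'_apply, map_zero, LinearMap.zero_apply]
  apply mulVec_conjTranspose_zR_injective hψ hα
  rw [Matrix.mulVec_mulVec, Matrix.mul_sub, ← Matrix.mul_assoc, conjTranspose_zR_mul_zR hψ,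
    Matrix.one_mul, Matrix.mul_one, sub_self, Matrix.zero_mulVec]

/-- A block of columns of a unitary matrix that reduces the induced representation is an
intertwiner with orthonormal columns, so multiplicity one leaves only a phase. -/
theorem exists_phase (hα : ∀ ν, α ∈ (ψ ν).blocks)
    {W : Matrix (Fin (m + 1) × Fin (S.dim α)) (Σ ν, (ψ ν).Idx) ℂ}
    (hW : UnitarilyReduces ψ W (ind (S.φ α))) (ν : I) :
    ∃ c : ℂ, ‖c‖ = 1 ∧ ∀ r x, W r ⟨ν, x⟩ = c * zR ψ α hα r ⟨ν, x⟩ := by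
  obtain ⟨h1, h2, h3⟩ := hW
  have hint : ∀ σ, (Matrix.of fun r x => W r ⟨ν, x⟩) * (ψ ν).rep σ =
      ind (S.φ α) σ * Matrix.of fun r x => W r ⟨ν, x⟩ := by
    intro σ
    refine (mul_eq_mul_blockDiagonal'_iff W σ).1 ?_ ν
    rw [← h3, ← Matrix.mul_assoc, ← Matrix.mul_assoc, h2, Matrix.one_mul]
  obtain ⟨c, hc⟩ := (ψ ν).eq_smul_zBlock (hα ν) hint
  refine ⟨c, ?_, fun r x => congrFun (congrFun hc r) x⟩
  obtain ⟨x⟩ := (ψ ν).nonempty_idx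
  have h4 : ((Matrix.of fun r x => W r ⟨ν, x⟩)ᴴ * Matrix.of fun r x => W r ⟨ν, x⟩) x x = 1 :=
    (congrFun (congrFun h1 ⟨ν, x⟩) ⟨ν, x⟩).trans (Matrix.one_apply_eq _)
  rw [hc, Matrix.conjTranspose_smul, Matrix.smul_mul, Matrix.mul_smul, PRIR.gram_self,
    Matrix.smul_apply, Matrix.smul_apply, Matrix.one_apply_eq, smul_eq_mul, smul_eq_mul, mul_one,
    Complex.star_def, Complex.conj_mul'] at h4
  have h5 : ‖c‖ ^ 2 = 1 := by exact_mod_cast h4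
  exact (pow_eq_one_iff_of_nonneg (norm_nonneg c) two_ne_zero).1 h5

end Reduction

end PRIRep

theorem mainTheorem3 (m : ℕ) {A I : Type*} [DecidableEq A] [Fintype I] [DecidableEq I]
    (S : PRIRep.IrrepSystem m A) (α : A) (ψ : I → PRIRep.PRIR S)
    (hψ : PRIRep.ListsConstituents ψ (PRIRep.ind (S.φ α))) :
    ∃ hα : ∀ ν, α ∈ (ψ ν).blocks,
      PRIRep.UnitarilyReduces ψ (PRIRep.zR ψ α hα) (PRIRep.ind (S.φ α)) ∧
      ∀ W : Matrix (Fin (m + 1) × Fin (S.dim α)) (Σ ν : I, (ψ ν).Idx) ℂ,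
        PRIRep.UnitarilyReduces ψ W (PRIRep.ind (S.φ α)) →
        ∃ c : I → ℂ, (∀ ν, ‖c ν‖ = 1) ∧
          ∀ r ν x, W r ⟨ν, x⟩ = c ν * PRIRep.zR ψ α hα r ⟨ν, x⟩ := by
  have hα := hψ.mem_blocks
  have h1 := PRIRep.conjTranspose_zR_mul_zR hψ hα
  refine ⟨hα, ⟨h1, PRIRep.zR_mul_conjTranspose_zR hψ hα, fun σ => ?_⟩, fun W hW => ?_⟩
  · rw [Matrix.mul_assoc, PRIRep.ind_mul_zR, ← Matrix.mul_assoc, h1, Matrix.one_mul]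
  · choose c hc hcW using PRIRep.exists_phase hα hW
    exact ⟨c, hc, fun r ν x => hcW ν r x⟩
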